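/- Setting. There are $N\ge1$ agents and $K\ge1$ arms. Each pull of arm $k$ gives a vector of rewards $(x_1,\dots,x_N)\in[0,1]^N$, one for each agent, drawn from a fixed law $\nu_k$ independently of all other pulls (the coordinates of one vector may be dependent). Let $\mu^*_{i,k}$ be the mean reward of agent $i$ from arm $k$, let $F_i=\{j:\mu^*_{i,j}=\max_k\mu^*_{i,k}\}$ be the favourite set of agent $i$, and assume that $F_i\neq[K]$ for at least one agent, so that $$\Delta_{\min}=\min_{i\in[N]}\ \min_{j\in F_i}\ \min_{k\notin F_i}\,(\mu^*_{i,j}-\mu^*_{i,k})>0$$ is defined (the minimum is over all such triples $(i,j,k)$). Algorithm, with parameters $\gamma\in(0,1)$ and $\alpha\ge1$. In rounds $1,\dots,K$ each arm is pulled once. In a round $t>K$, let $n_k$ be the number of earlier pulls of arm $k$, $\hat\mu_{i,k}$ the mean of the rewards that agent $i$ received in them, and $z_k=\sqrt{2\ln(NKt)/n_k}$. With probability $t^{-(1-\gamma)}$, independently of the past, the round is an exploration round: a uniformly random arm is pulled and no favourite sets are computed. Otherwise, for each agent $i$ an arm $j_i\in\arg\max_j\hat\mu_{i,j}$ is chosen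 and the estimated favourite set is $$\hat F_i(t)=\{k:\hat\mu_{i,k}+\alpha z_k\ \ge\ \hat\mu_{i,j_i}-\alpha z_{j_i}\};$$ then an arm is drawn from a policy $p$ that maximizes $\prod_i\sum_{j\in\hat F_i(t)}p_j$ over all $p\in[0,1]^K$ for which there are $y_{ij}\ge0$ with $y_{ij}=0$ for $j\notin\hat F_i(t)$, $\sum_{j\in\hat F_i(t)}y_{ij}=1/N$ for all $i$, and $\sum_{i:j\in\hat F_i(t)}y_{ij}=p_j$ for all $j$. Ties in both choices are broken arbitrarily, as a function of $t$, $(n_k)$ and $(\hat\mu_{i,k})$. Regret. $R^{PF}(T)$ is the number of rounds $t\in\{1,\dots,T\}$ in which $\hat F_i(t)\ne F_i$ for some agent $i$, where the rounds in which no favourite sets are computed (the initial rounds and the exploration rounds) also count as mismatches. Theorem. For every $\gamma\in(0,1)$ there is a constant $C>0$, depending only on $\gamma$, such that for all $N$, $K$, all reward laws as above, all $\alpha\ge1$, all tie-breaking rules and all $T\ge1$, with probability at least $1-\dfrac{1}{(NK)^3\,T^{\gamma}}$, $$R^{PF}(T)\ \le\ C\left(T^\gamma+\left[\frac{(1+\alpha)^2\,\gamma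 K\ln(NKT)}{\Delta_{\min}^2}\right]^{1/\gamma}\right).$$ -/

import Mathlib

noncomputable section

/-! ### The bandit instance -/

/-- The true mean reward of agent `i` for arm `k`, where `ν k` is the joint law of the vector of
the agents' rewards when arm `k` is pulled. -/
def meanReward {N K : ℕ} (ν : Fin K → MeasureTheory.Measure (Fin N → ℝ))
    (i : Fin N) (k : Fin K) : ℝ :=
  ∫ x, x i ∂(ν k)

open Classical in
/-- The favourite arms of each agent with respect to a matrix of means. -/
def favouriteSet {N K : ℕ} (μ : Fin N → Fin K → ℝ) (i : Fin N) : Finset (Fin K) :=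
  Finset.univ.filter fun j => ∀ k, μ i k ≤ μ i j

/-- All differences `μ i j - μ i k` with `j` a favourite arm of agent `i` and `k` not a favourite
arm of agent `i`; the minimal gap is the least element of this set. -/
def favouriteGaps {N K : ℕ} (μ : Fin N → Fin K → ℝ) : Set ℝ :=
  {d | ∃ i, ∃ j ∈ favouriteSet μ i, ∃ k, k ∉ favouriteSet μ i ∧ d = μ i j - μ i k}

/-! ### The procedural fairness optimization problem -/

open Classical in
/-- Feasibility of the policy `p` with decision shares `y` for the favourite sets `F`. -/
structure IsPFFeasible {N K : ℕ} (F : Fin N → Finset (Fin K)) (p : Fin K → ℝ)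
    (y : Fin N → Fin K → ℝ) : Prop where
  share_nonneg : ∀ i j, 0 ≤ y i j
  share_support : ∀ i j, j ∉ F i → y i j = 0
  share_sum : ∀ i, ∑ j ∈ F i, y i j = 1 / (N : ℝ)
  policy_eq : ∀ j, ∑ i ∈ Finset.univ.filter (fun i => j ∈ F i), y i j = p j
  policy_mem : ∀ j, 0 ≤ p j ∧ p j ≤ 1

/-- The Nash product of the decision shares of a policy. -/
def shareNash {N K : ℕ} (F : Fin N → Finset (Fin K)) (p : Fin K → ℝ) : ℝ :=
  ∏ i, ∑ j ∈ F i, p j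

/-- `p` solves the procedural fairness optimization problem for the favourite sets `F`. -/
def IsPFOptimal {N K : ℕ} (F : Fin N → Finset (Fin K)) (p : Fin K → ℝ) : Prop :=
  (∃ y, IsPFFeasible F p y) ∧
    ∀ p' y', IsPFFeasible F p' y' → shareNash F p' ≤ shareNash F p

/-! ### The learning algorithm -/

/-- The data kept by the learner: pull counts of the arms and estimated mean rewards. -/
abbrev LearnerState (N K : ℕ) : Type := (Fin K → ℕ) × (Fin N → Fin K → ℝ)

/-- The two choices that the algorithm leaves open, made as functions of the time step and of the
learner's data: which empirically best arm is taken for each agent, and which of the optimal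
solutions of the procedural fairness problem is used. -/
structure PFChoices (N K : ℕ) where
  best : ℕ → LearnerState N K → Fin N → Fin K
  best_isMax : ∀ (t : ℕ) (s : LearnerState N K) (i : Fin N) (k : Fin K),
    s.2 i k ≤ s.2 i (best t s i)
  solve : ℕ → LearnerState N K → (Fin N → Finset (Fin K)) → Fin K → ℝ
  solve_optimal : ∀ (t : ℕ) (s : LearnerState N K) (F : Fin N → Finset (Fin K)),
    (∀ i, (F i).Nonempty) → IsPFOptimal F (solve t s F)

/-- The confidence radius at time `t` of an arm that has been pulled `n ≥ 1` times. -/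
def confRadius (N K t n : ℕ) : ℝ :=
  Real.sqrt (2 * Real.log ((N : ℝ) * K * t) / n)

open Classical in
/-- The estimated favourite set of agent `i` at time `t`. The radius of an arm without pulls is
`+∞`, so that any comparison with an infinite bound holds. -/
def estimatedSet {N K : ℕ} (α : ℝ) (c : PFChoices N K) (t : ℕ) (s : LearnerState N K)
    (i : Fin N) : Finset (Fin K) :=
  Finset.univ.filter fun k =>
    s.1 k = 0 ∨ s.1 (c.best t s i) = 0 ∨
      s.2 i (c.best t s i) - α * confRadius N K t (s.1 (c.best t s i)) ≤
        s.2 i k + α * confRadius N K t (s.1 k)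

open Classical in
/-- Sampling an arm from the policy `p` with a uniform variable `u`, by inversion of the
cumulative sums: the least arm `k` with `u ≤ p 0 + ... + p k`. -/
def sampleArm {K : ℕ} [NeZero K] (p : Fin K → ℝ) (u : ℝ) : Fin K :=
  if h : (Finset.univ.filter fun k => u ≤ ∑ j ∈ Finset.Iic k, p j).Nonempty then
    (Finset.univ.filter fun k => u ≤ ∑ j ∈ Finset.Iic k, p j).min' h
  else 0

/-- The learner's randomness in one round: a uniform variable for the exploration coin, a
uniformly random arm, and a uniform variable for sampling from the policy. -/
abbrev RoundSeed (K : ℕ) : Type := unitInterval × Fin K × unitInterval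

/-- The sample space: the learner's randomness in every round, and for every arm `k` and every
`m : ℕ` the vector of the agents' rewards at the pull number `m + 1` of arm `k`. -/
abbrev BanditSpace (N K : ℕ) : Type := (ℕ → RoundSeed K) × (Fin K → ℕ → Fin N → ℝ)

/-- The law of the learner's randomness in one round: three independent variables. -/
def roundLaw (K : ℕ) [NeZero K] : MeasureTheory.Measure (RoundSeed K) :=
  (MeasureTheory.volume : MeasureTheory.Measure unitInterval).prod
    ((PMF.uniformOfFintype (Fin K)).toMeasure.prod
      (MeasureTheory.volume : MeasureTheory.Measure unitInterval))

instance (K : ℕ) [NeZero K] : MeasureTheory.IsProbabilityMeasure (roundLaw K) := by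
  unfold roundLaw; infer_instance

/-- All rounds, all arms and all pulls are independent, and every pull of arm `k` yields a reward
vector with law `ν k`. Dependence between the agents' rewards of one pull is allowed. -/
def banditLaw {N K : ℕ} [NeZero K] (ν : Fin K → MeasureTheory.Measure (Fin N → ℝ))
    [∀ k, MeasureTheory.IsProbabilityMeasure (ν k)] :
    MeasureTheory.Measure (BanditSpace N K) :=
  (MeasureTheory.Measure.infinitePi fun _ : ℕ => roundLaw K).prod
    (MeasureTheory.Measure.pi fun k => MeasureTheory.Measure.infinitePi fun _ : ℕ => ν k)

/-- Round `t` is a forced exploration round; this has probability `t ^ (-(1 - γ))`. -/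
def explores {N K : ℕ} (γ : ℝ) (ω : BanditSpace N K) (t : ℕ) : Prop :=
  ((ω.1 t).1 : ℝ) ≤ (t : ℝ) ^ (-(1 - γ))

open Classical in
/-- The arm pulled in round `t ≥ 1` when the learner's data before that round is `s`. The rounds
`1, ..., K` pull each arm once; afterwards a uniformly random arm is pulled in an exploration
round, and an arm drawn from the current procedurally fair policy otherwise. -/
def pulledArm {N K : ℕ} [NeZero K] (γ α : ℝ) (c : PFChoices N K) (ω : BanditSpace N K)
    (t : ℕ) (s : LearnerState N K) : Fin K :=
  if t ≤ K then Fin.ofNat K (t - 1)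
  else if explores γ ω t then (ω.1 t).2.1
  else sampleArm (c.solve t s (estimatedSet α c t s)) (ω.1 t).2.2

/-- The update after pulling arm `k` and observing the reward vector `r`: the count of `k`
increases by one and the estimates for `k` undergo an incremental mean update. -/
def pullUpdate {N K : ℕ} (s : LearnerState N K) (k : Fin K) (r : Fin N → ℝ) :
    LearnerState N K :=
  (Function.update s.1 k (s.1 k + 1),
    fun i => Function.update (s.2 i) k (s.2 i k + (r i - s.2 i k) / ((s.1 k : ℝ) + 1)))

/-- The learner's data after `t` rounds. -/
def learnerState {N K : ℕ} [NeZero K] (γ α : ℝ) (c : PFChoices N K) (ω : BanditSpace N K) :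
    ℕ → LearnerState N K
  | 0 => (fun _ => 0, fun _ _ => 0)
  | t + 1 =>
    let s := learnerState γ α c ω t
    let k := pulledArm γ α c ω (t + 1) s
    pullUpdate s k (ω.2 k (s.1 k))

open Classical in
/-- The favourite sets estimated by the algorithm in round `t ≥ 1`. None are computed in the
initial rounds `1, ..., K` and in the forced exploration rounds. -/
def estimatedSets {N K : ℕ} [NeZero K] (γ α : ℝ) (c : PFChoices N K) (ω : BanditSpace N K)
    (t : ℕ) : Option (Fin N → Finset (Fin K)) :=
  if t ≤ K ∨ explores γ ω t then none
  else some (estimatedSet α c t (learnerState γ α c ω (t - 1)))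

open Classical in
/-- The procedural fairness regret up to time `T`: the number of rounds `t ∈ {1, ..., T}` in which
the estimated favourite sets are not the true ones `F`. Rounds in which no estimate is computed
count as mismatches, so that this is at least the number of rounds `t` for which the confidence
bounds at time `t` give some agent a wrong set. -/
def pfRegret {N K : ℕ} [NeZero K] (γ α : ℝ) (c : PFChoices N K)
    (F : Fin N → Finset (Fin K)) (ω : BanditSpace N K) (T : ℕ) : ℕ :=
  ((Finset.Icc 1 T).filter fun t => estimatedSets γ α c ω t ≠ some F).card

end

/-!
The rewards are read from tapes: the pull number `m + 1` of arm `k` yields `ω.2 k m`, whatever the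
algorithm did before. The estimate of an arm is therefore always the mean of an initial segment of
its tape (`learnerState_estimate`), and the number of its pulls is at least the number of forced
exploration rounds that drew it, which is a function of the seeds alone
(`card_explorationPulls_le_count`). So three events that do not involve the adaptive behaviour of
the algorithm suffice:

* some initial segment of length `n ≤ t` of some tape has a mean outside its confidence interval of
  a time `t ≥ 12 T ^ γ` (`deviationEvent`). By Hoeffding's inequality and a union bound, time `t`
  contributes `2 / (N K t) ^ 3`, and the sum over `t ≥ 12 T ^ γ` is at most
  `1 / (3 (N K) ^ 3 T ^ γ)`;
* some arm has few exploration pulls at a time beyond the threshold `τ` (`fewPullsEvent`). Each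
  round in `(K, t)` explores with probability at least `t ^ (γ - 1)`, so for `t ≥ 2 K + 2` at least
  `t ^ γ / (2 K)` such pulls of each arm are expected, and Chernoff's bound applies;
* there are many exploration rounds up to time `T`. Their expected number is at most `T ^ γ / γ`,
  and Chernoff's bound applies with a deviation of order `ln (N K T)`.

Outside these events, past `τ` every radius is so small compared with the minimal gap that the
estimated favourite sets are the true ones (`estimatedSet_eq_favouriteSet`). Hence only the rounds
up to `τ` and the exploration rounds are mismatches (`pfRegret_le`). The threshold `τ` is
`12 T ^ γ` plus a multiple of the second term of the regret bound, which also dominates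
`K ln (N K T)`, because the gap is at most `1` and there are at least two arms. The
policy that the algorithm plays in the other rounds is irrelevant. The tie-breaking rules need not
be measurable, so probabilities of events that involve them are estimated by outer measure only.
-/

open MeasureTheory ProbabilityTheory

/-! ### The learner's data along the reward tape -/

section LearnerData

variable {N K : ℕ} [NeZero K] (γ α : ℝ) (c : PFChoices N K) (ω : BanditSpace N K)

theorem learnerState_succ_count (t : ℕ) (k : Fin K) :
    (learnerState γ α c ω (t + 1)).1 k = (learnerState γ α c ω t).1 k +
      if pulledArm γ α c ω (t + 1) (learnerState γ α c ω t) = k then 1 else 0 := by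
  simp only [learnerState, pullUpdate, Function.update_apply, eq_comm (a := k)]
  split_ifs with h
  · rw [h]
  · rfl

theorem learnerState_count_mono (k : Fin K) :
    Monotone fun t => (learnerState γ α c ω t).1 k :=
  monotone_nat_of_le_succ fun t => by rw [learnerState_succ_count]; exact Nat.le_add_right _ _

theorem learnerState_count_le (t : ℕ) (k : Fin K) : (learnerState γ α c ω t).1 k ≤ t := by
  induction t with
  | zero => simp [learnerState]
  | succ t ih => rw [learnerState_succ_count]; split_ifs <;> omega

/-- The incremental update maintains the empirical mean of the rewards read so far from the tape
of arm `k`. For an arm without pulls both sides are `0`. -/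
theorem learnerState_estimate (t : ℕ) (i : Fin N) (k : Fin K) :
    (learnerState γ α c ω t).2 i k =
      (∑ m ∈ Finset.range ((learnerState γ α c ω t).1 k), ω.2 k m i) /
        (learnerState γ α c ω t).1 k := by
  induction t with
  | zero => simp [learnerState]
  | succ t ih =>
    rw [learnerState_succ_count]
    by_cases h : pulledArm γ α c ω (t + 1) (learnerState γ α c ω t) = k
    · rw [if_pos h, Finset.sum_range_succ]
      simp only [learnerState, pullUpdate, h, Function.update_self]
      rw [ih]
      set n := (learnerState γ α c ω t).1 k
      push_cast
      rcases Nat.eq_zero_or_pos n with hn | hn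
      · simp [hn]
      · field_simp
        ring
    · rw [if_neg h, add_zero, ← ih]
      simp [learnerState, pullUpdate, Ne.symm h]

theorem one_le_learnerState_count {t : ℕ} (ht : K ≤ t) (k : Fin K) :
    1 ≤ (learnerState γ α c ω t).1 k := by
  have hk := k.isLt
  have harm : pulledArm γ α c ω (k + 1) (learnerState γ α c ω k) = k := by
    rw [pulledArm, if_pos (by omega)]
    simp
  have h : (learnerState γ α c ω (k + 1)).1 k ≤ (learnerState γ α c ω t).1 k :=
    learnerState_count_mono γ α c ω k (by omega)
  rw [learnerState_succ_count, if_pos harm] at h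
  omega

open Classical in
/-- The pulls of arm `k` in the forced exploration rounds among `K + 1, ..., t` are a lower bound
for its pull count. They depend on the learner's seeds only. -/
theorem card_explorationPulls_le_count (t : ℕ) (k : Fin K) :
    ((Finset.Ioc K t).filter fun s => explores γ ω s ∧ (ω.1 s).2.1 = k).card ≤
      (learnerState γ α c ω t).1 k := by
  induction t with
  | zero => simp
  | succ t ih =>
    rcases Nat.lt_or_ge t K with htK | htK
    · rw [Finset.Ioc_eq_empty (by omega)]; simp
    · have hI : Finset.Ioc K (t + 1) = insert (t + 1) (Finset.Ioc K t) := by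
        ext s; simp only [Finset.mem_Ioc, Finset.mem_insert]; omega
      rw [hI, Finset.filter_insert, learnerState_succ_count]
      split_ifs with h1 h2 h2
      · exact (Finset.card_insert_le _ _).trans (by omega)
      · refine absurd ?_ h2
        rw [pulledArm, if_neg (by omega), if_pos h1.1]
        exact h1.2
      · omega
      · omega

end LearnerData

/-! ### Correctness of the estimated favourite sets -/

/-- If every estimate is within its confidence radius and every radius, widened by `1 + α`, is
below half the minimal gap, then the estimated favourite set is the true one. -/
theorem estimatedSet_eq_favouriteSet {N K : ℕ} [NeZero K] {α Δ : ℝ} (hα : 1 ≤ α)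
    (c : PFChoices N K) (t : ℕ) (s : LearnerState N K) (μ : Fin N → Fin K → ℝ) (i : Fin N)
    (hΔ : ∀ d ∈ favouriteGaps μ, Δ ≤ d)
    (hpos : ∀ k, s.1 k ≠ 0)
    (hdev : ∀ k, |s.2 i k - μ i k| ≤ confRadius N K t (s.1 k))
    (hsmall : ∀ k, 2 * ((1 + α) * confRadius N K t (s.1 k)) < Δ) :
    estimatedSet α c t s i = favouriteSet μ i := by
  have hα' : ∀ k, confRadius N K t (s.1 k) ≤ α * confRadius N K t (s.1 k) := fun k =>
    le_mul_of_one_le_left (Real.sqrt_nonneg _) hα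
  ext k
  set b := c.best t s i with hb
  simp only [estimatedSet, Finset.mem_filter, Finset.mem_univ, true_and, hpos, false_or, ← hb]
  have hdk := abs_le.1 (hdev k)
  have hdb := abs_le.1 (hdev b)
  constructor
  · intro h
    by_contra hk
    obtain ⟨j, -, hj⟩ := Finset.exists_max_image Finset.univ (μ i) Finset.univ_nonempty
    have hjF : j ∈ favouriteSet μ i := by
      simpa [favouriteSet] using fun k => hj k (Finset.mem_univ k)
    have hgap := hΔ _ ⟨i, j, hjF, k, hk, rfl⟩
    have hdj := abs_le.1 (hdev j)
    have hbj := c.best_isMax t s i j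
    -- `j` itself need not be empirically best, so its radius enters besides those of `k` and `b`.
    nlinarith [hsmall k, hsmall b, hsmall j, hα' j]
  · intro hk
    have hkb : μ i b ≤ μ i k := by
      simp only [favouriteSet, Finset.mem_filter, Finset.mem_univ, true_and] at hk
      exact hk b
    linarith [hα' k, hα' b]

/-! ### Tail bounds for counts of independent events and for empirical means -/

theorem mgf_indicator_one_le {Ω : Type*} [MeasurableSpace Ω] {P : Measure Ω}
    [IsProbabilityMeasure P] {A : Set Ω} (hA : MeasurableSet A) (l : ℝ) :
    mgf (A.indicator fun _ => 1) P l ≤ Real.exp ((Real.exp l - 1) * P.real A) := by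
  have h1 : (fun x => Real.exp (l * A.indicator (fun _ => (1 : ℝ)) x)) =
      fun x => 1 + A.indicator (fun _ => Real.exp l - 1) x := by
    ext x
    by_cases hx : x ∈ A <;> simp [hx]
  rw [mgf, h1, integral_add (integrable_const _) ((integrable_const _).indicator hA),
    integral_indicator_const _ hA]
  simp only [integral_const, probReal_univ, smul_eq_mul, one_mul]
  rw [add_comm, mul_comm]
  exact Real.add_one_le_exp _

open Classical in
theorem sum_indicator_eq_card {Ω : Type*} (A : ℕ → Set Ω) (S : Finset ℕ) (ω : ℕ → Ω) :
    (∑ s ∈ S, fun ω : ℕ → Ω => (A s).indicator (fun _ => (1 : ℝ)) (ω s)) ω =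
      ((S.filter fun s => ω s ∈ A s).card : ℝ) := by
  rw [Finset.sum_apply, Finset.card_filter]
  push_cast
  rfl

section Chernoff

variable {Ω : Type*} [MeasurableSpace Ω] {P : Measure Ω} [IsProbabilityMeasure P]

theorem mgf_sum_indicator_le {A : ℕ → Set Ω} (hA : ∀ s, MeasurableSet (A s)) (S : Finset ℕ)
    (l : ℝ) :
    mgf (∑ s ∈ S, fun ω : ℕ → Ω => (A s).indicator (fun _ => (1 : ℝ)) (ω s))
        (Measure.infinitePi fun _ : ℕ => P) l ≤
      Real.exp ((Real.exp l - 1) * ∑ s ∈ S, P.real (A s)) := by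
  have hm : ∀ s, Measurable ((A s).indicator fun _ => (1 : ℝ)) := fun s =>
    measurable_const.indicator (hA s)
  have hind := iIndepFun_infinitePi (P := fun _ : ℕ => P) hm
  rw [hind.mgf_sum (fun s => (hm s).comp (measurable_pi_apply s)), Finset.mul_sum, Real.exp_sum]
  refine Finset.prod_le_prod (fun s _ => mgf_nonneg) fun s _ => ?_
  have hmp := measurePreserving_eval_infinitePi (fun _ : ℕ => P) s
  refine le_trans (le_of_eq ?_) (mgf_indicator_one_le (P := P) (hA s) l)
  have hl : AEStronglyMeasurable (fun x => Real.exp (l * (A s).indicator (fun _ => (1 : ℝ)) x))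
      ((Measure.infinitePi fun _ : ℕ => P).map (Function.eval s)) :=
    (((hm s).const_mul l).exp).aestronglyMeasurable
  conv_rhs => rw [← hmp.map_eq]
  rw [mgf_map hmp.measurable.aemeasurable hl]
  rfl

theorem integrable_exp_mul_sum_indicator {A : ℕ → Set Ω} (hA : ∀ s, MeasurableSet (A s))
    (S : Finset ℕ) (l : ℝ) :
    Integrable (fun ω => Real.exp (l *
      (∑ s ∈ S, fun ω : ℕ → Ω => (A s).indicator (fun _ => (1 : ℝ)) (ω s)) ω))
      (Measure.infinitePi fun _ : ℕ => P) := by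
  have hm : ∀ s, Measurable ((A s).indicator fun _ => (1 : ℝ)) := fun s =>
    measurable_const.indicator (hA s)
  refine integrable_exp_mul_of_mem_Icc (a := 0) (b := S.card) ?_ (ae_of_all _ fun ω => ?_)
  · exact Finset.aemeasurable_sum S fun s _ =>
      ((hm s).comp (measurable_pi_apply s)).aemeasurable
  · rw [Finset.sum_apply]
    constructor
    · exact Finset.sum_nonneg fun s _ => Set.indicator_nonneg (fun _ _ => zero_le_one) _
    · refine (Finset.sum_le_card_nsmul S _ 1 fun s _ => ?_).trans (by simp)
      exact Set.indicator_le_self' (fun _ _ => zero_le_one) _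

open Classical in
/-- Chernoff bound for the upper tail of a number of independent events; the factor `2` stands
for `e - 1`. -/
theorem measureReal_le_card_le_exp {A : ℕ → Set Ω} (hA : ∀ s, MeasurableSet (A s))
    (S : Finset ℕ) (a : ℝ) :
    (Measure.infinitePi fun _ : ℕ => P).real
        {ω | a ≤ ((S.filter fun s => ω s ∈ A s).card : ℝ)} ≤
      Real.exp (2 * ∑ s ∈ S, P.real (A s) - a) := by
  have h := measure_ge_le_exp_mul_mgf a zero_le_one
    (integrable_exp_mul_sum_indicator (P := P) hA S 1)
  simp only [sum_indicator_eq_card] at h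
  refine h.trans ((mul_le_mul_of_nonneg_left (mgf_sum_indicator_le hA S 1)
    (Real.exp_nonneg _)).trans ?_)
  rw [← Real.exp_add, Real.exp_le_exp]
  have hS : 0 ≤ ∑ s ∈ S, P.real (A s) := Finset.sum_nonneg fun s _ => measureReal_nonneg
  nlinarith [Real.exp_one_lt_d9]

open Classical in
/-- Chernoff bound for the lower tail of a number of independent events; the factor `1 / 2` stands
for `1 - 1 / e`. -/
theorem measureReal_card_le_le_exp {A : ℕ → Set Ω} (hA : ∀ s, MeasurableSet (A s))
    (S : Finset ℕ) (a : ℝ) :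
    (Measure.infinitePi fun _ : ℕ => P).real
        {ω | ((S.filter fun s => ω s ∈ A s).card : ℝ) ≤ a} ≤
      Real.exp (a - (∑ s ∈ S, P.real (A s)) / 2) := by
  have h := measure_le_le_exp_mul_mgf a (neg_nonpos.2 zero_le_one)
    (integrable_exp_mul_sum_indicator (P := P) hA S (-1))
  simp only [sum_indicator_eq_card] at h
  refine h.trans ((mul_le_mul_of_nonneg_left (mgf_sum_indicator_le hA S (-1))
    (Real.exp_nonneg _)).trans ?_)
  rw [← Real.exp_add, Real.exp_le_exp]
  have hS : 0 ≤ ∑ s ∈ S, P.real (A s) := Finset.sum_nonneg fun s _ => measureReal_nonneg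
  have he : Real.exp (-1) ≤ 1 / 2 := by
    rw [Real.exp_neg, inv_le_comm₀ (Real.exp_pos _) (by norm_num)]
    linarith [Real.exp_one_gt_d9]
  nlinarith

end Chernoff

/-- Two-sided Hoeffding bound for the sum of `n` independent variables `f (x 0), f (x 1), ...`
with values in `[0, 1]`. -/
theorem measureReal_le_abs_sum_sub_le {Ω : Type*} [MeasurableSpace Ω] {P : Measure Ω}
    [IsProbabilityMeasure P] {f : Ω → ℝ} (hf : Measurable f)
    (hb : ∀ᵐ x ∂P, f x ∈ Set.Icc (0 : ℝ) 1) (n : ℕ) {ε : ℝ} (hε : 0 ≤ ε) :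
    (Measure.infinitePi fun _ : ℕ => P).real
        {x | ε ≤ |∑ m ∈ Finset.range n, f (x m) - n * ∫ y, f y ∂P|} ≤
      2 * Real.exp (-2 * ε ^ 2 / n) := by
  set Q := Measure.infinitePi fun _ : ℕ => P
  have hQ : ∀ m, MeasurePreserving (fun x : ℕ → Ω => x m) Q P := fun m =>
    measurePreserving_eval_infinitePi (fun _ : ℕ => P) m
  set e := ∫ y, f y ∂P with he
  have hP : HasSubgaussianMGF (fun y => f y - e) (1 / 4) P := by
    have h := hasSubgaussianMGF_of_mem_Icc hf.aemeasurable hb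
    convert h using 1
    ext; norm_num
  have hsub : ∀ m, HasSubgaussianMGF (fun x : ℕ → Ω => f (x m) - e) (1 / 4) Q := fun m => by
    rw [← (hQ m).map_eq] at hP
    exact hP.of_map (hQ m).measurable.aemeasurable
  have hind : iIndepFun (fun m (x : ℕ → Ω) => f (x m) - e) Q :=
    iIndepFun_infinitePi (P := fun _ : ℕ => P) (X := fun _ y => f y - e)
      fun _ => hf.sub_const e
  have h1 := HasSubgaussianMGF.measure_sum_range_ge_le_of_iIndepFun hind (n := n)
    (fun m _ => hsub m) hε
  have h2 := HasSubgaussianMGF.measure_sum_range_ge_le_of_iIndepFun (n := n)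
    (hind.comp (fun _ => fun y : ℝ => -y) fun _ => measurable_neg)
    (fun m _ => (hsub m).neg) hε
  have hexp : Real.exp (-ε ^ 2 / (2 * n * ((1 / 4 : NNReal) : ℝ))) =
      Real.exp (-2 * ε ^ 2 / n) := by
    congr 1
    rcases Nat.eq_zero_or_pos n with hn | hn
    · simp [hn]
    · push_cast
      field_simp
      norm_num
  rw [hexp] at h1 h2
  refine (measureReal_mono (fun x hx => ?_)).trans
    ((measureReal_union_le _ _).trans ((add_le_add h1 h2).trans (two_mul _).ge))
  simp only [Set.mem_ofPred_eq, Set.mem_union, Function.comp_apply, Finset.sum_neg_distrib,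
    Finset.sum_sub_distrib, Finset.sum_const, Finset.card_range, nsmul_eq_mul] at hx ⊢
  exact le_abs.1 hx

/-! ### The laws of the seeds and of the reward tapes -/

theorem roundLaw_real_explore {K : ℕ} [NeZero K] {p : ℝ} (hp0 : 0 ≤ p) (hp1 : p ≤ 1) :
    (roundLaw K).real {r | (r.1 : ℝ) ≤ p} = p := by
  have hset : {r : RoundSeed K | (r.1 : ℝ) ≤ p} =
      Set.Iic (⟨p, hp0, hp1⟩ : unitInterval) ×ˢ Set.univ := by
    ext r; simp [← Subtype.coe_le_coe]
  rw [hset, roundLaw, measureReal_prod_prod, probReal_univ, mul_one, measureReal_def,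
    unitInterval.volume_Iic, ENNReal.toReal_ofReal hp0]

theorem roundLaw_real_explore_arm {K : ℕ} [NeZero K] {p : ℝ} (hp0 : 0 ≤ p) (hp1 : p ≤ 1)
    (k : Fin K) :
    (roundLaw K).real {r | (r.1 : ℝ) ≤ p ∧ r.2.1 = k} = p / K := by
  have hset : {r : RoundSeed K | (r.1 : ℝ) ≤ p ∧ r.2.1 = k} =
      Set.Iic (⟨p, hp0, hp1⟩ : unitInterval) ×ˢ ({k} ×ˢ Set.univ) := by
    ext r; simp [← Subtype.coe_le_coe]
  rw [hset, roundLaw, measureReal_prod_prod, measureReal_prod_prod, probReal_univ, mul_one,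
    measureReal_def, unitInterval.volume_Iic, ENNReal.toReal_ofReal hp0, measureReal_def,
    PMF.toMeasure_apply_singleton _ _ (measurableSet_singleton k)]
  simp [div_eq_mul_inv]

section Law

variable {N K : ℕ} [NeZero K] (ν : Fin K → Measure (Fin N → ℝ)) [∀ k, IsProbabilityMeasure (ν k)]

instance : IsProbabilityMeasure (banditLaw ν) := by
  unfold banditLaw; infer_instance

/-- An event about the seeds has at most its probability under the law of the seeds. No
measurability is needed for this inequality between outer measures. -/
theorem banditLaw_real_seeds_le (S : Set (ℕ → RoundSeed K)) :
    (banditLaw ν).real {ω | ω.1 ∈ S} ≤ (Measure.infinitePi fun _ : ℕ => roundLaw K).real S := by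
  have h : MeasurePreserving Prod.fst (banditLaw ν)
      (Measure.infinitePi fun _ : ℕ => roundLaw K) := measurePreserving_fst
  refine ENNReal.toReal_mono (measure_ne_top _ _) ?_
  conv_rhs => rw [← h.map_eq]
  exact Measure.le_map_apply h.aemeasurable S

theorem banditLaw_real_tape_le (k : Fin K) (S : Set (ℕ → Fin N → ℝ)) :
    (banditLaw ν).real {ω | ω.2 k ∈ S} ≤ (Measure.infinitePi fun _ : ℕ => ν k).real S := by
  have h2 : MeasurePreserving Prod.snd (banditLaw ν)
      (Measure.pi fun k => Measure.infinitePi fun _ : ℕ => ν k) := measurePreserving_snd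
  have h := (measurePreserving_eval (fun k => Measure.infinitePi fun _ : ℕ => ν k) k).comp h2
  refine ENNReal.toReal_mono (measure_ne_top _ _) ?_
  conv_rhs => rw [← h.map_eq]
  exact Measure.le_map_apply h.aemeasurable S

end Law

/-! ### The forced exploration rounds -/

theorem sum_rpow_neg_le {γ : ℝ} (hγ0 : 0 < γ) (hγ1 : γ < 1) (T : ℕ) :
    ∑ t ∈ Finset.Icc 1 T, (t : ℝ) ^ (-(1 - γ)) ≤ (T : ℝ) ^ γ / γ := by
  induction T with
  | zero => simp [Real.zero_rpow hγ0.ne']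
  | succ T ih =>
    rw [Finset.sum_Icc_succ_top (by omega)]
    refine (add_le_add_left ih _).trans ?_
    have hx : (0 : ℝ) < (T + 1 : ℕ) := by positivity
    set x : ℝ := ((T + 1 : ℕ) : ℝ) with hxdef
    have hTx : (T : ℝ) = x * (1 + -1 / x) := by
      field_simp; rw [hxdef]; push_cast; ring
    have hx1 : 1 ≤ x := by rw [hxdef]; exact_mod_cast Nat.le_add_left 1 T
    have hs : -1 ≤ -1 / x := by rw [le_div_iff₀ hx]; linarith
    -- Bernoulli's inequality at `-1 / x` bounds the increment of the power from below.
    have hB := rpow_one_add_le_one_add_mul_self hs hγ0.le hγ1.le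
    have hpow : x ^ (-(1 - γ)) = x ^ γ / x := by
      rw [neg_sub, Real.rpow_sub_one hx.ne']
    have hT : (T : ℝ) ^ γ ≤ x ^ γ - γ * (x ^ γ / x) := by
      rw [hTx, Real.mul_rpow hx.le (by linarith)]
      calc x ^ γ * (1 + -1 / x) ^ γ ≤ x ^ γ * (1 + γ * (-1 / x)) := by gcongr
        _ = _ := by ring
    rw [hpow, ← sub_nonneg]
    have : x ^ γ / γ - ((T : ℝ) ^ γ / γ + x ^ γ / x) =
        (x ^ γ - γ * (x ^ γ / x) - (T : ℝ) ^ γ) / γ := by field_simp; ring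
    rw [this]
    exact div_nonneg (by linarith) hγ0.le

section Exploration

variable {N K : ℕ} [NeZero K] (ν : Fin K → Measure (Fin N → ℝ)) [∀ k, IsProbabilityMeasure (ν k)]

theorem exploreProb_le_one {γ : ℝ} (hγ1 : γ < 1) {t : ℕ} (ht : 1 ≤ t) : (t : ℝ) ^ (-(1 - γ)) ≤ 1 :=
  Real.rpow_le_one_of_one_le_of_nonpos (by exact_mod_cast ht) (by linarith)

open Classical in
theorem banditLaw_real_le_card_explores {γ : ℝ} (hγ0 : 0 < γ) (hγ1 : γ < 1)
    (T : ℕ) (a : ℝ) :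
    (banditLaw ν).real {ω | a ≤ (((Finset.Icc 1 T).filter fun t => explores γ ω t).card : ℝ)} ≤
      Real.exp (2 * ((T : ℝ) ^ γ / γ) - a) := by
  set A : ℕ → Set (RoundSeed K) := fun t => {r | (r.1 : ℝ) ≤ (t : ℝ) ^ (-(1 - γ))} with hAdef
  have hA : ∀ t, MeasurableSet (A t) := fun t =>
    measurableSet_le (by fun_prop) measurable_const
  refine ((banditLaw_real_seeds_le ν
    {x | a ≤ (((Finset.Icc 1 T).filter fun t => x t ∈ A t).card : ℝ)}).trans
    (measureReal_le_card_le_exp hA _ a)).trans ?_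
  rw [Real.exp_le_exp]
  have hsum : ∑ t ∈ Finset.Icc 1 T, (roundLaw K).real (A t) ≤ (T : ℝ) ^ γ / γ := by
    refine le_trans (le_of_eq (Finset.sum_congr rfl fun t ht => ?_)) (sum_rpow_neg_le hγ0 hγ1 T)
    exact roundLaw_real_explore (by positivity)
      (exploreProb_le_one hγ1 (Finset.mem_Icc.1 ht).1)
  linarith

open Classical in
/-- For `u + 1 ≥ 2 K + 2` there are at least `(u + 1) / 2` rounds in `(K, u]`, and each of them is
an exploration round that pulls arm `k` with probability at least `(u + 1) ^ (-(1 - γ)) / K`. -/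
theorem banditLaw_real_card_explorationPulls_le {γ : ℝ} (hγ1 : γ < 1) {u : ℕ}
    (hu : 2 * K + 2 ≤ u + 1) (k : Fin K) (a : ℝ) :
    (banditLaw ν).real {ω | (((Finset.Ioc K u).filter fun s =>
        explores γ ω s ∧ (ω.1 s).2.1 = k).card : ℝ) ≤ a} ≤
      Real.exp (a - ((u + 1 : ℕ) : ℝ) ^ γ / (4 * K)) := by
  -- `A` is kept opaque: its membership predicate unfolds to a conjunction with another
  -- decidability instance.
  obtain ⟨A, hAdef⟩ : ∃ A : ℕ → Set (RoundSeed K),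
      A = fun t : ℕ => {r : RoundSeed K | (r.1 : ℝ) ≤ (t : ℝ) ^ (-(1 - γ)) ∧ r.2.1 = k} := ⟨_, rfl⟩
  have hcoin : Measurable fun r : RoundSeed K => (r.1 : ℝ) := by fun_prop
  have harm : Measurable fun r : RoundSeed K => r.2.1 := by fun_prop
  have hA : ∀ t, MeasurableSet (A t) := fun t => by
    rw [hAdef]
    exact (measurableSet_le hcoin measurable_const).inter (harm (measurableSet_singleton k))
  have hset : {ω : BanditSpace N K | (((Finset.Ioc K u).filter fun s =>
        explores γ ω s ∧ (ω.1 s).2.1 = k).card : ℝ) ≤ a} =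
      {ω | ω.1 ∈ {x : ℕ → RoundSeed K |
        (((Finset.Ioc K u).filter fun t => x t ∈ A t).card : ℝ) ≤ a}} := by
    ext ω
    simp only [Set.mem_ofPred_eq]
    rw [Finset.filter_congr fun s _ =>
      show (explores γ ω s ∧ (ω.1 s).2.1 = k) ↔ ω.1 s ∈ A s by rw [hAdef]; rfl]
  rw [hset]
  refine ((banditLaw_real_seeds_le ν _).trans (measureReal_card_le_le_exp hA _ a)).trans ?_
  rw [Real.exp_le_exp]
  have hK : (0 : ℝ) < K := by exact_mod_cast Nat.pos_of_ne_zero (NeZero.ne K)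
  set x : ℝ := ((u + 1 : ℕ) : ℝ) with hx
  have hx0 : 0 < x := by positivity
  have hterm : ∀ s ∈ Finset.Ioc K u, x ^ (-(1 - γ)) / K ≤ (roundLaw K).real (A s) := by
    intro s hs
    have hs' := Finset.mem_Ioc.1 hs
    rw [hAdef, roundLaw_real_explore_arm (by positivity) (exploreProb_le_one hγ1 (by omega)) k]
    gcongr ?_ / _
    refine Real.rpow_le_rpow_of_nonpos ?_ ?_ (by linarith)
    · exact_mod_cast (by omega : 0 < s)
    · rw [hx]; exact_mod_cast (by omega : s ≤ u + 1)
  have hsum := Finset.card_nsmul_le_sum _ _ _ hterm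
  rw [Nat.card_Ioc, nsmul_eq_mul, Nat.cast_sub (by omega)] at hsum
  have hhalf : x / 2 ≤ (u : ℝ) - K := by
    have : (2 * K + 2 : ℝ) ≤ u + 1 := by exact_mod_cast hu
    rw [hx]; push_cast; linarith
  have hpow : x * x ^ (-(1 - γ)) = x ^ γ := by
    rw [neg_sub, Real.rpow_sub_one hx0.ne']; field_simp
  have h1 : x / 2 * (x ^ (-(1 - γ)) / K) ≤ ((u : ℝ) - K) * (x ^ (-(1 - γ)) / K) := by
    gcongr
  have h2 : x / 2 * (x ^ (-(1 - γ)) / K) = 2 * (x ^ γ / (4 * K)) := by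
    rw [← hpow]; field_simp; ring
  linarith

end Exploration

/-! ### Concentration of the empirical means -/

theorem sum_one_div_sq_le (T : ℕ) : ∑ t ∈ Finset.Icc 1 T, 1 / (t : ℝ) ^ 2 ≤ 2 := by
  suffices h : ∀ T : ℕ, 1 ≤ T → ∑ t ∈ Finset.Icc 1 T, 1 / (t : ℝ) ^ 2 ≤ 2 - 1 / (T : ℝ) by
    rcases Nat.eq_zero_or_pos T with hT | hT
    · simp [hT]
    · exact (h T hT).trans (sub_le_self _ (by positivity))
  intro T hT
  induction T, hT using Nat.le_induction with
  | base => norm_num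
  | succ T hT ih =>
    rw [Finset.sum_Icc_succ_top (by omega)]
    have hT0 : (0 : ℝ) < T := by exact_mod_cast hT
    have h : 1 / ((T + 1 : ℕ) : ℝ) ^ 2 ≤ 1 / (T : ℝ) - 1 / ((T + 1 : ℕ) : ℝ) := by
      push_cast
      rw [div_sub_div _ _ hT0.ne' (by positivity), div_le_div_iff₀ (by positivity) (by positivity)]
      nlinarith
    linarith

section Concentration

variable {N K : ℕ} [NeZero N] [NeZero K] (ν : Fin K → Measure (Fin N → ℝ))
  [∀ k, IsProbabilityMeasure (ν k)]

theorem banditLaw_real_confRadius_le_dev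
    (hν : ∀ k, ∀ᵐ x ∂(ν k), ∀ i, 0 ≤ x i ∧ x i ≤ 1) {t n : ℕ} (ht : 1 ≤ t)
    (hn : 1 ≤ n) (i : Fin N) (k : Fin K) :
    (banditLaw ν).real {ω | confRadius N K t n ≤
        |(∑ m ∈ Finset.range n, ω.2 k m i) / n - meanReward ν i k|} ≤
      2 / ((N : ℝ) * K * t) ^ 4 := by
  have hn0 : (0 : ℝ) < n := by exact_mod_cast hn
  have hN : (1 : ℝ) ≤ N := by exact_mod_cast NeZero.one_le
  have hK : (1 : ℝ) ≤ K := by exact_mod_cast NeZero.one_le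
  have ht1 : (1 : ℝ) ≤ t := by exact_mod_cast ht
  have hX : (1 : ℝ) ≤ (N : ℝ) * K * t :=
    one_le_mul_of_one_le_of_one_le (one_le_mul_of_one_le_of_one_le hN hK) ht1
  have hlog : 0 ≤ Real.log ((N : ℝ) * K * t) := Real.log_nonneg hX
  have hH := measureReal_le_abs_sum_sub_le (P := ν k) (f := fun x => x i)
    (measurable_pi_apply i) ((hν k).mono fun x hx => hx i) n
    (ε := n * confRadius N K t n) (mul_nonneg hn0.le (Real.sqrt_nonneg _))
  refine (measureReal_mono (fun ω hω => ?_)).trans ((banditLaw_real_tape_le ν k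
    {x | n * confRadius N K t n ≤
      |∑ m ∈ Finset.range n, x m i - n * ∫ y, y i ∂(ν k)|}).trans (hH.trans (le_of_eq ?_)))
  · simp only [Set.mem_ofPred_eq] at hω ⊢
    have hfac : ∑ m ∈ Finset.range n, ω.2 k m i - n * ∫ y, y i ∂(ν k) =
        n * ((∑ m ∈ Finset.range n, ω.2 k m i) / n - meanReward ν i k) := by
      rw [meanReward]; field_simp
    rw [hfac, abs_mul, abs_of_pos hn0]
    gcongr
  · have hexp : -2 * ((n : ℝ) * confRadius N K t n) ^ 2 / n =
        -(4 * Real.log ((N : ℝ) * K * t)) := by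
      rw [mul_pow, confRadius, Real.sq_sqrt (by positivity)]
      field_simp
      ring
    rw [hexp, Real.exp_neg, div_eq_mul_inv]
    congr 2
    rw [mul_comm, Real.exp_mul, Real.exp_log (by linarith)]
    norm_cast

/-- The event that some empirical mean after `n ≤ t` pulls leaves its confidence interval of some
time `t ∈ [M, T]`. -/
def deviationEvent (M : ℝ) (T : ℕ) : Set (BanditSpace N K) :=
  ⋃ t ∈ (Finset.Icc 1 T).filter fun t : ℕ => M ≤ t, ⋃ i ∈ (Finset.univ : Finset (Fin N)),
    ⋃ k ∈ (Finset.univ : Finset (Fin K)), ⋃ n ∈ Finset.Icc 1 t,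
      {ω | confRadius N K t n ≤
        |(∑ m ∈ Finset.range n, ω.2 k m i) / n - meanReward ν i k|}

/-- The terms of the union bound sum to `2 / (N K t) ^ 3` at time `t`; one factor `1 / t` is spent
on the lower end `M` of the range of times. -/
theorem banditLaw_real_deviationEvent_le
    (hν : ∀ k, ∀ᵐ x ∂(ν k), ∀ i, 0 ≤ x i ∧ x i ≤ 1) {M : ℝ} (hM : 0 < M) (T : ℕ) :
    (banditLaw ν).real (deviationEvent ν M T) ≤ 4 / (((N : ℝ) * K) ^ 3 * M) := by
  have hN : (0 : ℝ) < N := by exact_mod_cast Nat.pos_of_ne_zero (NeZero.ne N)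
  have hK : (0 : ℝ) < K := by exact_mod_cast Nat.pos_of_ne_zero (NeZero.ne K)
  have hterm : ∀ t ∈ (Finset.Icc 1 T).filter fun t : ℕ => M ≤ t,
      (banditLaw ν).real (⋃ i ∈ (Finset.univ : Finset (Fin N)),
        ⋃ k ∈ (Finset.univ : Finset (Fin K)), ⋃ n ∈ Finset.Icc 1 t,
          {ω | confRadius N K t n ≤
            |(∑ m ∈ Finset.range n, ω.2 k m i) / n - meanReward ν i k|}) ≤
        2 / (((N : ℝ) * K) ^ 3 * M) * (1 / (t : ℝ) ^ 2) := by
    intro t ht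
    obtain ⟨ht1, htM⟩ := Finset.mem_filter.1 ht
    have ht1 := (Finset.mem_Icc.1 ht1).1
    have ht0 : (0 : ℝ) < t := by exact_mod_cast ht1
    calc _ ≤ ∑ i : Fin N, ∑ k : Fin K, ∑ n ∈ Finset.Icc 1 t, 2 / ((N : ℝ) * K * t) ^ 4 := by
          refine (measureReal_biUnion_finset_le _ _).trans (Finset.sum_le_sum fun i _ => ?_)
          refine (measureReal_biUnion_finset_le _ _).trans (Finset.sum_le_sum fun k _ => ?_)
          refine (measureReal_biUnion_finset_le _ _).trans (Finset.sum_le_sum fun n hn => ?_)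
          exact banditLaw_real_confRadius_le_dev ν hν ht1 (Finset.mem_Icc.1 hn).1 i k
      _ = 2 / (((N : ℝ) * K) ^ 3 * t) * (1 / (t : ℝ) ^ 2) := by
          simp only [Finset.sum_const, Finset.card_univ, Fintype.card_fin, Nat.card_Icc,
            nsmul_eq_mul, Nat.add_sub_cancel]
          field_simp
      _ ≤ _ := by gcongr
  calc (banditLaw ν).real (deviationEvent ν M T)
      ≤ ∑ t ∈ (Finset.Icc 1 T).filter fun t : ℕ => M ≤ t,
          2 / (((N : ℝ) * K) ^ 3 * M) * (1 / (t : ℝ) ^ 2) :=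
        (measureReal_biUnion_finset_le _ _).trans (Finset.sum_le_sum hterm)
    _ ≤ ∑ t ∈ Finset.Icc 1 T, 2 / (((N : ℝ) * K) ^ 3 * M) * (1 / (t : ℝ) ^ 2) :=
        Finset.sum_le_sum_of_subset_of_nonneg (Finset.filter_subset _ _)
          fun _ _ _ => by positivity
    _ ≤ 2 / (((N : ℝ) * K) ^ 3 * M) * 2 := by
        rw [← Finset.mul_sum]
        gcongr
        exact sum_one_div_sq_le T
    _ = _ := by ring

end Concentration

/-! ### The regret on the good event -/

theorem meanReward_mem_Icc {N K : ℕ} (ν : Fin K → Measure (Fin N → ℝ))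
    [∀ k, IsProbabilityMeasure (ν k)] (hν : ∀ k, ∀ᵐ x ∂(ν k), ∀ i, 0 ≤ x i ∧ x i ≤ 1) (i : Fin N)
    (k : Fin K) : meanReward ν i k ∈ Set.Icc (0 : ℝ) 1 := by
  have hb : ∀ᵐ x ∂(ν k), x i ∈ Set.Icc (0 : ℝ) 1 := (hν k).mono fun x hx => hx i
  have hint : Integrable (fun x : Fin N → ℝ => x i) (ν k) :=
    Integrable.of_mem_Icc 0 1 (measurable_pi_apply i).aemeasurable hb
  refine ⟨integral_nonneg_of_ae (hb.mono fun x hx => hx.1), ?_⟩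
  have h := integral_mono_ae hint (integrable_const 1) (hb.mono fun x hx => hx.2)
  simpa [meanReward] using h

/-- If `Δ` is the minimal gap of means in `[0, 1]`, then `0 < Δ ≤ 1` and there are two arms. -/
theorem minGap_bounds {N K : ℕ} (ν : Fin K → Measure (Fin N → ℝ))
    [∀ k, IsProbabilityMeasure (ν k)] (hν : ∀ k, ∀ᵐ x ∂(ν k), ∀ i, 0 ≤ x i ∧ x i ≤ 1) {Δ : ℝ}
    (hΔ : Δ ∈ favouriteGaps (meanReward ν)) : 0 < Δ ∧ Δ ≤ 1 ∧ 2 ≤ K := by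
  obtain ⟨i, j, hj, k, hk, rfl⟩ := hΔ
  have hjk : j ≠ k := fun h => hk (h ▸ hj)
  simp only [favouriteSet, Finset.mem_filter, Finset.mem_univ, true_and, not_forall,
    not_le] at hj hk
  obtain ⟨l, hl⟩ := hk
  have h1 := meanReward_mem_Icc ν hν i j
  have h2 := meanReward_mem_Icc ν hν i k
  refine ⟨by linarith [hj l], by linarith [h1.2, h2.1], ?_⟩
  have := j.isLt
  have := k.isLt
  have : (j : ℕ) ≠ k := fun h => hjk (Fin.ext h)
  omega

section Regret

variable {N K : ℕ} [NeZero K] (ν : Fin K → Measure (Fin N → ℝ))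

open Classical in
/-- The event that in some round `t ∈ (τ, T]` some arm has at most `t ^ γ / (8 K)` earlier forced
exploration pulls, a quarter of the guaranteed expectation. -/
def fewPullsEvent (N : ℕ) {K : ℕ} (γ τ : ℝ) (T : ℕ) : Set (BanditSpace N K) :=
  ⋃ t ∈ (Finset.Icc 1 T).filter fun t : ℕ => τ < t, ⋃ k ∈ (Finset.univ : Finset (Fin K)),
    {ω | (((Finset.Ioc K (t - 1)).filter fun s =>
      explores γ ω s ∧ (ω.1 s).2.1 = k).card : ℝ) ≤ (t : ℝ) ^ γ / (8 * K)}

open Classical in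
/-- A union bound whose terms are all at most `exp (-b)`. -/
theorem banditLaw_real_fewPullsEvent_le [∀ k, IsProbabilityMeasure (ν k)] {γ : ℝ}
    (hγ0 : 0 < γ) (hγ1 : γ < 1) {τ b : ℝ} (T : ℕ) (hτ0 : 0 ≤ τ)
    (hτK : 2 * (K : ℝ) + 2 ≤ τ) (hτb : b ≤ τ ^ γ / (8 * K)) :
    (banditLaw ν).real (fewPullsEvent N γ τ T) ≤ T * K * Real.exp (-b) := by
  have hK : (0 : ℝ) < K := by exact_mod_cast Nat.pos_of_ne_zero (NeZero.ne K)
  have hterm : ∀ t ∈ (Finset.Icc 1 T).filter fun t : ℕ => τ < t,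
      (banditLaw ν).real (⋃ k ∈ (Finset.univ : Finset (Fin K)),
        {ω | (((Finset.Ioc K (t - 1)).filter fun s =>
          explores γ ω s ∧ (ω.1 s).2.1 = k).card : ℝ) ≤ (t : ℝ) ^ γ / (8 * K)}) ≤
        K * Real.exp (-b) := by
    intro t ht
    obtain ⟨ht1, hτt⟩ := Finset.mem_filter.1 ht
    obtain ⟨u, rfl⟩ : ∃ u, t = u + 1 := ⟨t - 1, by have := (Finset.mem_Icc.1 ht1).1; omega⟩
    have hu : 2 * K + 2 ≤ u + 1 := by
      have : (2 * (K : ℝ) + 2) ≤ ((u + 1 : ℕ) : ℝ) := hτK.trans hτt.le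
      exact_mod_cast this
    have hpow : τ ^ γ ≤ ((u + 1 : ℕ) : ℝ) ^ γ := Real.rpow_le_rpow hτ0 hτt.le hγ0.le
    have hdiv : τ ^ γ / (8 * K) ≤ ((u + 1 : ℕ) : ℝ) ^ γ / (8 * K) := by gcongr
    calc _ ≤ ∑ k : Fin K, Real.exp (-b) := by
          refine (measureReal_biUnion_finset_le _ _).trans (Finset.sum_le_sum fun k _ => ?_)
          refine (banditLaw_real_card_explorationPulls_le ν hγ1 hu k _).trans ?_
          rw [Real.exp_le_exp]
          have : ((u + 1 : ℕ) : ℝ) ^ γ / (4 * K) = 2 * (((u + 1 : ℕ) : ℝ) ^ γ / (8 * K)) := by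
            field_simp; norm_num
          linarith
      _ = _ := by simp
  calc _ ≤ ∑ t ∈ (Finset.Icc 1 T).filter fun t : ℕ => τ < t, K * Real.exp (-b) :=
        (measureReal_biUnion_finset_le _ _).trans (Finset.sum_le_sum hterm)
    _ ≤ ∑ t ∈ Finset.Icc 1 T, K * Real.exp (-b) :=
        Finset.sum_le_sum_of_subset_of_nonneg (Finset.filter_subset _ _)
          fun _ _ _ => by positivity
    _ = _ := by simp [mul_assoc]

/-- Outside the two bad events, the favourite sets are estimated correctly in every exploitation
round `t > τ`. -/
theorem estimatedSets_eq_favouriteSet [NeZero N] {γ α Δ M τ : ℝ} (hγ0 : 0 < γ) (hα : 1 ≤ α)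
    (c : PFChoices N K) (hΔ0 : 0 < Δ) (hΔ : ∀ d ∈ favouriteGaps (meanReward ν), Δ ≤ d) {T t : ℕ}
    (hτ0 : 0 ≤ τ) (hMτ : M ≤ τ) (hKτ : K < τ)
    (hτ : 64 * ((1 + α) ^ 2 * K * Real.log ((N : ℝ) * K * T) / Δ ^ 2) ≤ τ ^ γ)
    (htT : t ≤ T) (hτt : τ < t) {ω : BanditSpace N K} (hexp : ¬ explores γ ω t)
    (hdev : ω ∉ deviationEvent ν M T) (hfew : ω ∉ fewPullsEvent N γ τ T) :
    estimatedSets γ α c ω t = some (favouriteSet (meanReward ν)) := by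
  have hK : (0 : ℝ) < K := by exact_mod_cast Nat.pos_of_ne_zero (NeZero.ne K)
  have hN : (1 : ℝ) ≤ N := by exact_mod_cast NeZero.one_le
  have hK1 : (1 : ℝ) ≤ K := by exact_mod_cast NeZero.one_le
  have hKt : K < t := by exact_mod_cast hKτ.trans hτt
  have ht1 : (1 : ℝ) ≤ t := by exact_mod_cast (by omega : 1 ≤ t)
  have hX : (1 : ℝ) ≤ (N : ℝ) * K * t :=
    one_le_mul_of_one_le_of_one_le (one_le_mul_of_one_le_of_one_le hN hK1) ht1
  have htI : t ∈ Finset.Icc 1 T := Finset.mem_Icc.2 ⟨by omega, htT⟩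
  rw [estimatedSets, if_neg (by push Not; exact ⟨hKt, hexp⟩)]
  congr 1
  funext i
  set s := learnerState γ α c ω (t - 1) with hs
  have hpos : ∀ k, 1 ≤ s.1 k := fun k =>
    one_le_learnerState_count γ α c ω (by omega) k
  refine estimatedSet_eq_favouriteSet hα c t s _ i hΔ (fun k =>
    Nat.one_le_iff_ne_zero.1 (hpos k)) (fun k => ?_)
    fun k => ?_
  · by_contra hlt
    refine hdev ?_
    simp only [deviationEvent, Set.mem_iUnion]
    refine ⟨t, Finset.mem_filter.2 ⟨htI, hMτ.trans hτt.le⟩, i, Finset.mem_univ _, k,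
      Finset.mem_univ _, s.1 k, Finset.mem_Icc.2 ⟨hpos k, ?_⟩, ?_⟩
    · exact (learnerState_count_le γ α c ω (t - 1) k).trans (by omega)
    · rw [hs, learnerState_estimate, ← hs] at hlt
      exact (not_le.1 hlt).le
  · have hcount : (t : ℝ) ^ γ / (8 * K) < s.1 k := by
      by_contra hle
      refine hfew ?_
      simp only [fewPullsEvent, Set.mem_iUnion]
      refine ⟨t, Finset.mem_filter.2 ⟨htI, hτt⟩, k, Finset.mem_univ _, ?_⟩
      refine le_trans ?_ (not_lt.1 hle)
      exact_mod_cast card_explorationPulls_le_count γ α c ω (t - 1) k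
    have hpow : τ ^ γ ≤ (t : ℝ) ^ γ := Real.rpow_le_rpow hτ0 hτt.le hγ0.le
    have hlog : Real.log ((N : ℝ) * K * t) ≤ Real.log ((N : ℝ) * K * T) := by
      refine Real.log_le_log (by linarith) ?_
      gcongr
    have hn0 : (0 : ℝ) < s.1 k := by exact_mod_cast hpos k
    -- This many pulls bring the radius below `Δ / (2 (1 + α))`; together with the `8 K` of the
    -- exploration count it accounts for the factor `64`.
    have hlow : 8 * ((1 + α) ^ 2 * Real.log ((N : ℝ) * K * t) / Δ ^ 2) < s.1 k := by
      refine lt_of_le_of_lt ?_ hcount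
      rw [le_div_iff₀ (by positivity)]
      calc 8 * ((1 + α) ^ 2 * Real.log ((N : ℝ) * K * t) / Δ ^ 2) * (8 * K)
          = 64 * ((1 + α) ^ 2 * K * Real.log ((N : ℝ) * K * t) / Δ ^ 2) := by ring
        _ ≤ 64 * ((1 + α) ^ 2 * K * Real.log ((N : ℝ) * K * T) / Δ ^ 2) := by gcongr
        _ ≤ _ := hτ.trans hpow
    have hα0 : 0 < 1 + α := by linarith
    have hrad : confRadius N K t (s.1 k) < Δ / (2 * (1 + α)) := by
      rw [confRadius, Real.sqrt_lt' (by positivity), div_lt_iff₀ hn0, div_pow]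
      rw [← mul_div_assoc, div_lt_iff₀ (by positivity)] at hlow
      rw [div_mul_eq_mul_div, lt_div_iff₀ (by positivity)]
      nlinarith
    rw [lt_div_iff₀ (by positivity)] at hrad
    linarith

open Classical in
/-- Outside the two bad events, a mismatch occurs only up to time `τ` or in a forced exploration
round. -/
theorem pfRegret_le [NeZero N] {γ α Δ M τ : ℝ} (hγ0 : 0 < γ) (hα : 1 ≤ α)
    (c : PFChoices N K) (hΔ0 : 0 < Δ) (hΔ : ∀ d ∈ favouriteGaps (meanReward ν), Δ ≤ d) {T : ℕ}
    (hτ0 : 0 ≤ τ) (hMτ : M ≤ τ) (hKτ : K < τ)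
    (hτ : 64 * ((1 + α) ^ 2 * K * Real.log ((N : ℝ) * K * T) / Δ ^ 2) ≤ τ ^ γ)
    {ω : BanditSpace N K}
    (hdev : ω ∉ deviationEvent ν M T) (hfew : ω ∉ fewPullsEvent N γ τ T) :
    (pfRegret γ α c (favouriteSet (meanReward ν)) ω T : ℝ) ≤
      τ + (((Finset.Icc 1 T).filter fun t => explores γ ω t).card : ℝ) := by
  have hsub : ((Finset.Icc 1 T).filter fun t =>
      estimatedSets γ α c ω t ≠ some (favouriteSet (meanReward ν))) ⊆
      Finset.Icc 1 ⌊τ⌋₊ ∪ (Finset.Icc 1 T).filter fun t => explores γ ω t := by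
    intro t ht
    obtain ⟨htI, hne⟩ := Finset.mem_filter.1 ht
    obtain ⟨ht1, htT⟩ := Finset.mem_Icc.1 htI
    rw [Finset.mem_union, Finset.mem_filter, Finset.mem_Icc, Nat.le_floor_iff hτ0]
    by_contra hcon
    push Not at hcon
    exact hne (estimatedSets_eq_favouriteSet ν hγ0 hα c hΔ0 hΔ hτ0 hMτ hKτ hτ htT (hcon.1 ht1)
      (hcon.2 htI) hdev hfew)
  have hcard := (Finset.card_le_card hsub).trans (Finset.card_union_le _ _)
  rw [Nat.card_Icc, Nat.add_sub_cancel] at hcard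
  have hcard' : (pfRegret γ α c (favouriteSet (meanReward ν)) ω T : ℝ) ≤
      (⌊τ⌋₊ : ℝ) + (((Finset.Icc 1 T).filter fun t => explores γ ω t).card : ℝ) := by
    rw [pfRegret]
    exact_mod_cast hcard
  linarith [Nat.floor_le hτ0]

end Regret

/-! ### Choice of the threshold and of the constant -/

theorem one_div_mul_pow_five_le {γ Y T : ℝ} (hγ1 : γ < 1) (hY : 2 ≤ Y) (hT : 1 ≤ T) :
    1 / (Y * T) ^ 5 ≤ 1 / (Y ^ 3 * T ^ γ) / 4 := by
  have hT0 : 0 < T := by linarith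
  have hTγ : T ^ γ ≤ T ^ 3 := by
    rw [← Real.rpow_natCast]
    exact Real.rpow_le_rpow_of_exponent_le hT (by push_cast; linarith)
  have hX2 : 2 ≤ Y * T := by nlinarith
  rw [div_div]
  refine one_div_le_one_div_of_le (by positivity) ?_
  calc Y ^ 3 * T ^ γ * 4 ≤ Y ^ 3 * T ^ 3 * (Y * T) ^ 2 := by
        gcongr
        nlinarith
    _ = _ := by ring

/-- The factor that multiplies both terms of the regret bound. Its summands pay for the rounds
before `12 T ^ γ`, the expected exploration rounds, the rounds before the threshold
`(64 A / γ) ^ (1 / γ)` and the deviation of the number of exploration rounds. -/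
noncomputable def regretConstant (γ : ℝ) : ℝ :=
  12 + 2 / γ + (64 / γ) ^ (1 / γ) + 5 * (1 / (4 * γ)) ^ (1 / γ)

theorem regretConstant_pos {γ : ℝ} (hγ0 : 0 < γ) : 0 < regretConstant γ := by
  unfold regretConstant; positivity

/-- The threshold, the exploration rounds and the logarithmic deviation term are all dominated by
the two terms of the regret bound; `L` is a logarithm and `κ` the number of arms. -/
theorem threshold_add_exploration_le {γ A L κ P : ℝ} (hγ0 : 0 < γ) (hγ1 : γ < 1) (hA : 0 ≤ A)
    (hP : 0 ≤ P) (hκ : 1 ≤ κ) (hL : 0 ≤ L) (hκL : 1 ≤ κ * L) (hκLA : 4 * γ * (κ * L) ≤ A) :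
    (64 / γ * A) ^ (1 / γ) + 12 * P + (2 * (P / γ) + 5 * L) ≤
      regretConstant γ * (P + A ^ (1 / γ)) := by
  have hinv : 1 ≤ 1 / γ := (one_le_div hγ0).2 hγ1.le
  have hLA : L ≤ (1 / (4 * γ)) ^ (1 / γ) * A ^ (1 / γ) := by
    rw [← Real.mul_rpow (by positivity) hA]
    have hb : κ * L ≤ 1 / (4 * γ) * A := by
      rw [one_div_mul_eq_div, le_div_iff₀ (by positivity)]
      linarith
    exact ((le_mul_of_one_le_left hL hκ).trans hb).trans
      (Real.self_le_rpow_of_one_le (hκL.trans hb) hinv)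
  rw [Real.mul_rpow (by positivity) hA, regretConstant]
  have p1 : 0 ≤ (12 + 2 / γ) * A ^ (1 / γ) := by positivity
  have p2 : 0 ≤ ((64 / γ) ^ (1 / γ) + 5 * (1 / (4 * γ)) ^ (1 / γ)) * P := by positivity
  have p3 : 2 * (P / γ) = 2 / γ * P := by ring
  rw [p3]
  linarith

/-- Union bound for the complement of `G`. No measurability is assumed, only subadditivity of the
outer measure is used. -/
theorem one_sub_le_measureReal_of_cover {Ω : Type*} [MeasurableSpace Ω] {P : Measure Ω}
    [IsProbabilityMeasure P] {G B₁ B₂ B₃ : Set Ω} {b₁ b₂ b₃ : ℝ}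
    (hcover : ∀ ω, ω ∉ B₁ → ω ∉ B₂ → ω ∉ B₃ → ω ∈ G)
    (h₁ : P.real B₁ ≤ b₁) (h₂ : P.real B₂ ≤ b₂) (h₃ : P.real B₃ ≤ b₃) :
    1 - (b₁ + b₂ + b₃) ≤ P.real G := by
  have huniv : (Set.univ : Set Ω) ⊆ G ∪ (B₁ ∪ (B₂ ∪ B₃)) := fun ω _ => by
    by_contra h
    simp only [Set.mem_union, not_or] at h
    exact h.1 (hcover ω h.2.1 h.2.2.1 h.2.2.2)
  have h0 : 1 ≤ P.real (G ∪ (B₁ ∪ (B₂ ∪ B₃))) := by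
    rw [← probReal_univ (μ := P)]
    exact measureReal_mono huniv
  linarith [measureReal_union_le (μ := P) G (B₁ ∪ (B₂ ∪ B₃)),
    measureReal_union_le (μ := P) B₁ (B₂ ∪ B₃), measureReal_union_le (μ := P) B₂ B₃]

theorem mainTheorem2 (γ : ℝ) (hγ0 : 0 < γ) (hγ1 : γ < 1) :
    ∃ C : ℝ, 0 < C ∧
      ∀ (N K : ℕ) [NeZero N] [NeZero K]
        (ν : Fin K → MeasureTheory.Measure (Fin N → ℝ))
        [∀ k, MeasureTheory.IsProbabilityMeasure (ν k)]
        (_hν : ∀ k, ∀ᵐ x ∂(ν k), ∀ i, 0 ≤ x i ∧ x i ≤ 1)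
        (α : ℝ) (_hα : 1 ≤ α) (c : PFChoices N K)
        (Δ : ℝ) (_hΔ : IsLeast (favouriteGaps (meanReward ν)) Δ)
        (T : ℕ) (_hT : 1 ≤ T),
        1 - 1 / (((N : ℝ) * K) ^ 3 * (T : ℝ) ^ γ) ≤
          (banditLaw ν).real
            {ω | (pfRegret γ α c (favouriteSet (meanReward ν)) ω T : ℝ) ≤
              C * ((T : ℝ) ^ γ +
                ((1 + α) ^ 2 * γ * K * Real.log ((N : ℝ) * K * T) / Δ ^ 2) ^ (1 / γ))} := by
  classical
  refine ⟨regretConstant γ, regretConstant_pos hγ0, ?_⟩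
  intro N K _ _ ν _ hν α hα c Δ hΔ T hT
  obtain ⟨hΔ0, hΔ1, hK2⟩ := minGap_bounds ν hν hΔ.1
  have hN : (1 : ℝ) ≤ N := by exact_mod_cast NeZero.one_le
  have hK : (2 : ℝ) ≤ K := by exact_mod_cast hK2
  have hT1 : (1 : ℝ) ≤ T := by exact_mod_cast hT
  set Y : ℝ := (N : ℝ) * K with hY
  have hY2 : 2 ≤ Y := by nlinarith
  have hX2 : 2 ≤ Y * T := by nlinarith
  have hX0 : 0 < Y * T := by linarith
  set L : ℝ := Real.log (Y * T) with hL
  have hLlow : 1 / 2 ≤ L := by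
    have h := Real.log_le_log two_pos hX2
    linarith [Real.log_two_gt_d9]
  have hL0 : 0 ≤ L := by linarith
  set A : ℝ := (1 + α) ^ 2 * γ * K * L / Δ ^ 2 with hA
  have hA0 : 0 ≤ A := by positivity
  have hinv : 1 ≤ 1 / γ := (one_le_div hγ0).2 hγ1.le
  -- `A` dominates `K L`, because `α ≥ 1` and `Δ ≤ 1`.
  have hKLA : 4 * γ * (K * L) ≤ A := by
    rw [hA, le_div_iff₀ (by positivity)]
    have h1 : Δ ^ 2 ≤ 1 := pow_le_one₀ hΔ0.le hΔ1
    have h2 : 4 ≤ (1 + α) ^ 2 := by nlinarith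
    have h3 : 0 ≤ γ * (K * L) := by positivity
    nlinarith
  have hKL1 : 1 ≤ K * L := by nlinarith
  -- Past `τ₀` there are enough exploration pulls; the summand `12 T ^ γ` of `τ` pays for the union
  -- bound over the confidence intervals.
  set τ₀ : ℝ := (64 / γ * A) ^ (1 / γ) with hτ₀
  set τ : ℝ := τ₀ + 12 * (T : ℝ) ^ γ with hτ
  have hTγ : 1 ≤ (T : ℝ) ^ γ := Real.one_le_rpow hT1 hγ0.le
  have hbase : 256 * (K * L) ≤ 64 / γ * A := by
    calc 256 * (K * L) = 64 / γ * (4 * γ * (K * L)) := by field_simp; norm_num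
      _ ≤ _ := by gcongr
  have hτ₀low : 256 * (K * L) ≤ τ₀ :=
    hbase.trans (Real.self_le_rpow_of_one_le (by linarith) hinv)
  have hτ₀0 : 0 ≤ τ₀ := by linarith
  have hτK : 2 * (K : ℝ) + 2 ≤ τ := by nlinarith
  have hττ₀ : τ₀ ≤ τ := by linarith
  have hτpow : 64 / γ * A ≤ τ ^ γ := by
    calc 64 / γ * A = τ₀ ^ γ := by
          rw [hτ₀, ← Real.rpow_mul (by positivity), one_div_mul_cancel hγ0.ne', Real.rpow_one]
      _ ≤ τ ^ γ := Real.rpow_le_rpow hτ₀0 hττ₀ hγ0.le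
  have hτcond : 64 * ((1 + α) ^ 2 * K * L / Δ ^ 2) ≤ τ ^ γ := by
    refine le_trans (le_of_eq ?_) hτpow
    rw [hA]; field_simp
  set a : ℝ := 2 * ((T : ℝ) ^ γ / γ) + 5 * L with ha
  set B1 := deviationEvent ν (12 * (T : ℝ) ^ γ) T with hB1
  set B2 : Set (BanditSpace N K) := fewPullsEvent N γ τ T with hB2
  set B3 : Set (BanditSpace N K) :=
    {ω | a ≤ (((Finset.Icc 1 T).filter fun t => explores γ ω t).card : ℝ)} with hB3
  set δ : ℝ := 1 / (Y ^ 3 * (T : ℝ) ^ γ) with hδ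
  have hexpL : ∀ n : ℕ, Real.exp (-(n * L)) = 1 / (Y * T) ^ n := fun n => by
    rw [Real.exp_neg, hL, Real.exp_nat_mul, Real.exp_log hX0, one_div]
  have hX5 : 1 / (Y * T) ^ 5 ≤ δ / 4 := one_div_mul_pow_five_le hγ1 hY2 hT1
  have h1 : (banditLaw ν).real B1 ≤ δ / 3 := by
    refine (banditLaw_real_deviationEvent_le ν hν (by positivity) T).trans (le_of_eq ?_)
    rw [hδ, ← hY]; field_simp; norm_num
  have h2 : (banditLaw ν).real B2 ≤ δ / 4 := by
    refine (banditLaw_real_fewPullsEvent_le ν hγ0 hγ1 (b := (6 : ℕ) * L) T (by linarith)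
      hτK ?_).trans (le_trans ?_ hX5)
    · rw [le_div_iff₀ (by positivity)]
      push_cast
      nlinarith [hbase.trans hτpow]
    · rw [hexpL, mul_one_div, div_le_div_iff₀ (by positivity) (by positivity), one_mul,
        pow_succ (Y * (T : ℝ)) 5, mul_comm (_ ^ 5)]
      have hTK : (T : ℝ) * K ≤ Y * T := by
        rw [hY, mul_comm]
        gcongr
        exact le_mul_of_one_le_left (by linarith) hN
      gcongr
  have h3 : (banditLaw ν).real B3 ≤ δ / 4 := by
    refine (banditLaw_real_le_card_explores ν hγ0 hγ1 T a).trans (le_trans (le_of_eq ?_) hX5)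
    rw [← hexpL, ha]
    congr 1
    push_cast
    ring
  have hδ0 : 0 < δ := by positivity
  refine le_trans ?_ (one_sub_le_measureReal_of_cover (fun ω h₁ h₂ h₃ => ?_) h1 h2 h3)
  · linarith
  · have hreg := pfRegret_le ν hγ0 hα c hΔ0 hΔ.2 (by linarith) (by linarith) (by linarith) hτcond
      h₁ h₂
    have hexp : (((Finset.Icc 1 T).filter fun t => explores γ ω t).card : ℝ) < a := not_le.1 h₃
    exact (hreg.trans (by gcongr)).trans (threshold_add_exploration_le hγ0 hγ1 hA0 (by linarith)
      (by linarith) hL0 hKL1 hKLA)
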